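/- Let $U\subset\mathbb R^n$ be open and convex and let $f:U\to\mathbb R$ be convex. A sequence $(x_k)_{k\ge 0}$ in $U$ is called a \emph{BFGS sequence} for $f$ if $f$ is differentiable at every $x_k$ with $\nabla f(x_k)\neq 0$, and there exist $0<\mu<\nu<1$ and a (symmetric) positive definite $n\times n$ matrix $H_0$ such that, with $s_k=x_{k+1}-x_k$, $y_k=\nabla f(x_{k+1})-\nabla f(x_k)$ and $$V_k=I-\frac{s_ky_k^T}{s_k^Ty_k},\qquad H_{k+1}=V_kH_kV_k^T+\frac{s_ks_k^T}{s_k^Ty_k},$$ one has for all $k=0,1,2,\ldots$ $$H_k\nabla f(x_k)\in-\mathbb R_+s_k,\qquad f(x_{k+1})\le f(x_k)+\mu\,\nabla f(x_k)^Ts_k,\qquad \nabla f(x_{k+1})^Ts_k\ge\nu\,\nabla f(x_k)^Ts_k .$$ Let $(x_k)$ be a BFGS sequence in $U$ for $f$, and assume that the level set $\{x\in U: f(x)\le f(x_0)\}$ is compact (so that $f$ attains its minimum $\min f$ on $U$). Assume further that $f$ is twice differentiable, with $\nabla^2 f$ positive definite and continuous, throughout the set $\{x\in U: f(x)>\min f\}$.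 Then $f(x_k)\to\min f$ as $k\to\infty$. -/

import Mathlib

open Filter Topology

/-- The BFGS update of the inverse Hessian approximation `H` for a step `s` and a gradient
difference `y`: with `V = I - s yᵀ / (sᵀ y)`, it is `V H Vᵀ + s sᵀ / (sᵀ y)`. -/
noncomputable def bfgsUpdate {n : ℕ} (H : Matrix (Fin n) (Fin n) ℝ)
    (s y : EuclideanSpace ℝ (Fin n)) : Matrix (Fin n) (Fin n) ℝ :=
  (1 - (inner ℝ s y)⁻¹ • Matrix.vecMulVec s.ofLp y.ofLp) * H *
      (1 - (inner ℝ s y)⁻¹ • Matrix.vecMulVec s.ofLp y.ofLp).transpose +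
    (inner ℝ s y)⁻¹ • Matrix.vecMulVec s.ofLp s.ofLp

/-- The matrices `H₀, H₁, H₂, …` generated recursively by the BFGS update, with
`s_k = x_{k+1} - x_k` and `y_k = ∇f(x_{k+1}) - ∇f(x_k)`. -/
noncomputable def bfgsMatrix {n : ℕ} (f : EuclideanSpace ℝ (Fin n) → ℝ)
    (x : ℕ → EuclideanSpace ℝ (Fin n)) (H₀ : Matrix (Fin n) (Fin n) ℝ) :
    ℕ → Matrix (Fin n) (Fin n) ℝ
  | 0 => H₀
  | k + 1 => bfgsUpdate (bfgsMatrix f x H₀ k) (x (k + 1) - x k)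
      (gradient f (x (k + 1)) - gradient f (x k))

/-- `x` is a BFGS sequence for `f`. (In the theorem the iterates lie in an open set `U`, so the
conditions only depend on the values of `f` on `U`.) -/
def IsBFGSSequence {n : ℕ} (f : EuclideanSpace ℝ (Fin n) → ℝ)
    (x : ℕ → EuclideanSpace ℝ (Fin n)) : Prop :=
  (∀ k, DifferentiableAt ℝ f (x k) ∧ gradient f (x k) ≠ 0) ∧
  ∃ (μ ν : ℝ) (H₀ : Matrix (Fin n) (Fin n) ℝ),
    0 < μ ∧ μ < ν ∧ ν < 1 ∧ H₀.PosDef ∧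
    ∀ k,
      (∃ c : ℝ, 0 ≤ c ∧
        (bfgsMatrix f x H₀ k).mulVec (gradient f (x k)).ofLp = -(c • (x (k + 1) - x k).ofLp)) ∧
      f (x (k + 1)) ≤ f (x k) + μ * inner ℝ (gradient f (x k)) (x (k + 1) - x k) ∧
      ν * inner ℝ (gradient f (x k)) (x (k + 1) - x k) ≤
        inner ℝ (gradient f (x (k + 1))) (x (k + 1) - x k)

/-- The Hessian `∇²f(x)`, as the derivative of the gradient map. -/
noncomputable def hessian {n : ℕ} (f : EuclideanSpace ℝ (Fin n) → ℝ)
    (x : EuclideanSpace ℝ (Fin n)) : EuclideanSpace ℝ (Fin n) →L[ℝ] EuclideanSpace ℝ (Fin n) :=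
  fderiv ℝ (gradient f) x

/-- `f` is twice differentiable at every point of the (open) set `V`, and its Hessian is
continuous and positive definite throughout `V`. -/
def HasContinuousPosDefHessianOn {n : ℕ} (f : EuclideanSpace ℝ (Fin n) → ℝ)
    (V : Set (EuclideanSpace ℝ (Fin n))) : Prop :=
  (∀ x ∈ V, DifferentiableAt ℝ f x ∧ DifferentiableAt ℝ (gradient f) x) ∧
  ContinuousOn (hessian f) V ∧
  ∀ x ∈ V, ∀ v : EuclideanSpace ℝ (Fin n), v ≠ 0 → 0 < inner ℝ v (hessian f x v)

open Matrix in
lemma bfgsUpdate_mulVec {n : ℕ} (H : Matrix (Fin n) (Fin n) ℝ) (s y : EuclideanSpace ℝ (Fin n))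
    (v : Fin n → ℝ) :
    bfgsUpdate H s y *ᵥ v =
      (H *ᵥ (v - ((inner ℝ s y)⁻¹ * (s.ofLp ⬝ᵥ v)) • y.ofLp) -
        ((inner ℝ s y)⁻¹ *
          (y.ofLp ⬝ᵥ H *ᵥ (v - ((inner ℝ s y)⁻¹ * (s.ofLp ⬝ᵥ v)) • y.ofLp))) • s.ofLp) +
        ((inner ℝ s y)⁻¹ * (s.ofLp ⬝ᵥ v)) • s.ofLp := by
  simp only [bfgsUpdate, add_mulVec, ← mulVec_mulVec, transpose_sub, transpose_one,
    transpose_smul, transpose_vecMulVec, sub_mulVec, one_mulVec, smul_mulVec, vecMulVec_mulVec,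
    op_smul_eq_smul, smul_smul]

lemma inner_eq_dotProduct_ofLp {n : ℕ} (s y : EuclideanSpace ℝ (Fin n)) :
    inner ℝ s y = s.ofLp ⬝ᵥ y.ofLp := by
  rw [EuclideanSpace.inner_eq_star_dotProduct, dotProduct_comm]
  simp

open Matrix in
lemma Matrix.PosDef.dotProduct_mulVec_comm {n : ℕ} {H : Matrix (Fin n) (Fin n) ℝ} (hH : H.PosDef)
    (u v : Fin n → ℝ) : u ⬝ᵥ H *ᵥ v = v ⬝ᵥ H *ᵥ u := by
  have hT : Hᵀ = H := by simpa using hH.isHermitian.eq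
  rw [dotProduct_mulVec, ← mulVec_transpose, hT, dotProduct_comm]

open Matrix in
/-- The BFGS update preserves positive definiteness under the curvature condition. -/
lemma bfgsUpdate_posDef {n : ℕ} {H : Matrix (Fin n) (Fin n) ℝ} (hH : H.PosDef)
    {s y : EuclideanSpace ℝ (Fin n)} (hsy : 0 < inner ℝ s y) : (bfgsUpdate H s y).PosDef := by
  have hT : Hᵀ = H := by simpa using hH.isHermitian.eq
  refine posDef_iff_dotProduct_mulVec.2 ⟨?_, fun {v} hv => ?_⟩
  · rw [IsHermitian, conjTranspose_eq_transpose_of_trivial, bfgsUpdate]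
    simp only [transpose_add, transpose_mul, transpose_transpose, hT, transpose_smul,
      transpose_vecMulVec, mul_assoc]
  · set ρ := (inner ℝ s y)⁻¹ with hρ
    have hρ0 : 0 < ρ := inv_pos.2 hsy
    set w := v - (ρ * (s.ofLp ⬝ᵥ v)) • y.ofLp with hw
    have key : star v ⬝ᵥ bfgsUpdate H s y *ᵥ v = w ⬝ᵥ H *ᵥ w + ρ * (s.ofLp ⬝ᵥ v) ^ 2 := by
      rw [bfgsUpdate_mulVec, ← hρ, ← hw]
      have : v = w + (ρ * (s.ofLp ⬝ᵥ v)) • y.ofLp := by rw [hw]; abel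
      simp only [star_trivial, dotProduct_add, dotProduct_sub, dotProduct_smul, smul_eq_mul]
      rw [dotProduct_comm v s.ofLp]
      have h2 : v ⬝ᵥ H *ᵥ w = w ⬝ᵥ H *ᵥ w + (ρ * (s.ofLp ⬝ᵥ v)) * (y.ofLp ⬝ᵥ H *ᵥ w) := by
        conv_lhs => rw [this]
        simp only [add_dotProduct, smul_dotProduct, smul_eq_mul]
      rw [h2]; ring
    rw [key]
    rcases eq_or_ne (s.ofLp ⬝ᵥ v) 0 with h0 | h0
    · have hwv : w = v := by rw [hw, h0]; simp
      have := hH.dotProduct_mulVec_pos hv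
      rw [hwv, h0]; simpa using this
    · have h1 : 0 ≤ w ⬝ᵥ H *ᵥ w := by simpa using hH.posSemidef.dotProduct_mulVec_nonneg w
      positivity

open Matrix in
/-- The inverse form of the BFGS update. -/
lemma inv_bfgsUpdate {n : ℕ} {H : Matrix (Fin n) (Fin n) ℝ} (hH : H.PosDef)
    {s y : EuclideanSpace ℝ (Fin n)} (hsy : 0 < inner ℝ s y) :
    (bfgsUpdate H s y)⁻¹ =
      H⁻¹ - (s.ofLp ⬝ᵥ H⁻¹ *ᵥ s.ofLp)⁻¹ • vecMulVec (H⁻¹ *ᵥ s.ofLp) (H⁻¹ *ᵥ s.ofLp) +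
        (inner ℝ s y)⁻¹ • vecMulVec y.ofLp y.ofLp := by
  have hdet : IsUnit H.det := hH.det_pos.ne'.isUnit
  have hs0 : s.ofLp ≠ 0 := by
    intro h
    rw [inner_eq_dotProduct_ofLp, h] at hsy
    simp at hsy
  have hσ : 0 < s.ofLp ⬝ᵥ H⁻¹ *ᵥ s.ofLp := by simpa using hH.inv.dotProduct_mulVec_pos hs0
  have hBH : ∀ v, H⁻¹ *ᵥ H *ᵥ v = v := fun v => by
    rw [mulVec_mulVec, nonsing_inv_mul H hdet, one_mulVec]
  have hwH : ∀ v, (H⁻¹ *ᵥ s.ofLp) ⬝ᵥ H *ᵥ v = s.ofLp ⬝ᵥ v := fun v => by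
    rw [dotProduct_comm, hH.inv.dotProduct_mulVec_comm, hBH]
  apply inv_eq_left_inv
  apply ext_of_mulVec_single
  intro i
  generalize (Pi.single i 1 : Fin n → ℝ) = v
  rw [← mulVec_mulVec, bfgsUpdate_mulVec, one_mulVec]
  have hB : ∀ z, (H⁻¹ - (s.ofLp ⬝ᵥ H⁻¹ *ᵥ s.ofLp)⁻¹ •
        vecMulVec (H⁻¹ *ᵥ s.ofLp) (H⁻¹ *ᵥ s.ofLp) +
        (inner ℝ s y)⁻¹ • vecMulVec y.ofLp y.ofLp) *ᵥ z =
      H⁻¹ *ᵥ z - ((s.ofLp ⬝ᵥ H⁻¹ *ᵥ s.ofLp)⁻¹ * ((H⁻¹ *ᵥ s.ofLp) ⬝ᵥ z)) • (H⁻¹ *ᵥ s.ofLp) +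
        ((inner ℝ s y)⁻¹ * (y.ofLp ⬝ᵥ z)) • y.ofLp := fun z => by
    simp only [add_mulVec, sub_mulVec, smul_mulVec, vecMulVec_mulVec, op_smul_eq_smul, smul_smul]
  have hBs := hB s.ofLp
  rw [dotProduct_comm (H⁻¹ *ᵥ s.ofLp) s.ofLp, inv_mul_cancel₀ hσ.ne', dotProduct_comm y.ofLp,
    ← inner_eq_dotProduct_ofLp s y, inv_mul_cancel₀ hsy.ne', one_smul, one_smul, sub_self,
    zero_add] at hBs
  rw [mulVec_add, mulVec_sub, mulVec_smul, mulVec_smul, hBs, hB, hBH, hwH]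
  simp only [dotProduct_sub, dotProduct_smul, smul_eq_mul, ← inner_eq_dotProduct_ofLp s y]
  generalize y.ofLp ⬝ᵥ H *ᵥ (v - ((inner ℝ s y)⁻¹ * (s.ofLp ⬝ᵥ v)) • y.ofLp) = a
  ext j
  simp only [Pi.add_apply, Pi.sub_apply, Pi.smul_apply, smul_eq_mul]
  field_simp
  ring

open Matrix in
lemma det_bfgsUpdate {n : ℕ} {H : Matrix (Fin n) (Fin n) ℝ} (hH : H.PosDef)
    {s y : EuclideanSpace ℝ (Fin n)} (hsy : 0 < inner ℝ s y) :
    (bfgsUpdate H s y).det = H.det * ((s.ofLp ⬝ᵥ H⁻¹ *ᵥ s.ofLp) / inner ℝ s y) := by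
  have hdet : IsUnit H.det := hH.det_pos.ne'.isUnit
  have hs0 : s.ofLp ≠ 0 := by
    intro h
    rw [inner_eq_dotProduct_ofLp, h] at hsy
    simp at hsy
  have hσ : 0 < s.ofLp ⬝ᵥ H⁻¹ *ᵥ s.ofLp := by simpa using hH.inv.dotProduct_mulVec_pos hs0
  set σ := s.ofLp ⬝ᵥ H⁻¹ *ᵥ s.ofLp with hσd
  set ρ := (inner ℝ s y)⁻¹ with hρ
  set P : Matrix (Fin n) (Fin 2) ℝ := (of ![s.ofLp, H *ᵥ y.ofLp])ᵀ with hP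
  set Q : Matrix (Fin 2) (Fin n) ℝ := of ![-σ⁻¹ • (H⁻¹ *ᵥ s.ofLp), ρ • y.ofLp] with hQ
  have hBH : ∀ v, H⁻¹ *ᵥ H *ᵥ v = v := fun v => by
    rw [mulVec_mulVec, nonsing_inv_mul H hdet, one_mulVec]
  have hfac : (bfgsUpdate H s y)⁻¹ = H⁻¹ * (1 + P * Q) := by
    rw [inv_bfgsUpdate hH hsy]
    have hPQ : P * Q = -σ⁻¹ • vecMulVec s.ofLp (H⁻¹ *ᵥ s.ofLp) +
        ρ • vecMulVec (H *ᵥ y.ofLp) y.ofLp := by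
      ext i j
      simp [hP, hQ, mul_apply, Fin.sum_univ_two, vecMulVec_apply]
      ring
    rw [hPQ, mul_add, mul_one, mul_add, mul_smul_comm, mul_smul_comm, mul_vecMulVec,
      mul_vecMulVec, hBH, neg_smul, sub_eq_add_neg, add_assoc]
  have hQP : Q * P = of ![![-1, -σ⁻¹ * inner ℝ s y], ![1, ρ * (y.ofLp ⬝ᵥ H *ᵥ y.ofLp)]] := by
    have e : ∀ i j, (Q * P) i j = Q i ⬝ᵥ Pᵀ j := fun i j => rfl
    ext i j
    rw [e]
    fin_cases i <;> fin_cases j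
    · change (-σ⁻¹ • (H⁻¹ *ᵥ s.ofLp)) ⬝ᵥ s.ofLp = -1
      rw [smul_dotProduct, dotProduct_comm, ← hσd, smul_eq_mul]
      field_simp
    · change (-σ⁻¹ • (H⁻¹ *ᵥ s.ofLp)) ⬝ᵥ (H *ᵥ y.ofLp) = -σ⁻¹ * inner ℝ s y
      rw [smul_dotProduct, dotProduct_comm (H⁻¹ *ᵥ s.ofLp), hH.inv.dotProduct_mulVec_comm, hBH,
        inner_eq_dotProduct_ofLp, smul_eq_mul]
    · change (ρ • y.ofLp) ⬝ᵥ s.ofLp = 1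
      rw [smul_dotProduct, dotProduct_comm, ← inner_eq_dotProduct_ofLp, hρ, smul_eq_mul,
        inv_mul_cancel₀ hsy.ne']
    · change (ρ • y.ofLp) ⬝ᵥ (H *ᵥ y.ofLp) = ρ * (y.ofLp ⬝ᵥ H *ᵥ y.ofLp)
      rw [smul_dotProduct, smul_eq_mul]
  have hd : (1 + P * Q).det = inner ℝ s y / σ := by
    rw [det_one_add_mul_comm, hQP, det_fin_two]
    simp
    field_simp
  have hmain := congrArg det hfac
  rw [det_mul, hd, det_nonsing_inv, det_nonsing_inv, Ring.inverse_eq_inv, Ring.inverse_eq_inv]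
    at hmain
  have := congrArg (·⁻¹) hmain
  simpa [mul_comm] using this

/-- The function `B ↦ tr B - log det B` evaluated at `B = H⁻¹`. -/
noncomputable def traceLogDet {n : ℕ} (H : Matrix (Fin n) (Fin n) ℝ) : ℝ :=
  H⁻¹.trace + Real.log H.det

lemma traceLogDet_nonneg {n : ℕ} {H : Matrix (Fin n) (Fin n) ℝ} (hH : H.PosDef) :
    0 ≤ traceLogDet H := by
  have hB := hH.inv
  have hlog : Real.log H.det = -Real.log (H⁻¹).det := by
    rw [Matrix.det_nonsing_inv, Ring.inverse_eq_inv, Real.log_inv, neg_neg]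
  rw [traceLogDet, hlog, hB.isHermitian.trace_eq_sum_eigenvalues,
    hB.isHermitian.det_eq_prod_eigenvalues]
  simp only [RCLike.ofReal_real_eq_id, id]
  rw [Real.log_prod (fun i _ => (hB.eigenvalues_pos i).ne'), ← sub_eq_add_neg,
    ← Finset.sum_sub_distrib]
  refine Finset.sum_nonneg fun i _ => ?_
  have := Real.log_le_sub_one_of_pos (hB.eigenvalues_pos i)
  linarith

open Matrix in
/-- One BFGS step with a search direction `-H g` changes `traceLogDet` in a controlled way. -/
lemma traceLogDet_bfgsUpdate_le {n : ℕ} {H : Matrix (Fin n) (Fin n) ℝ} (hH : H.PosDef)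
    {s y g : EuclideanSpace ℝ (Fin n)} {c ν M : ℝ} (hc : 0 < c) (hg : g ≠ 0)
    (hHg : H *ᵥ g.ofLp = -(c • s.ofLp)) (hν : ν < 1) (hgs : inner ℝ g s < 0)
    (hsy : (1 - ν) * -inner ℝ g s ≤ inner ℝ s y) (hM : ‖y‖ ^ 2 ≤ M * inner ℝ s y) :
    traceLogDet (bfgsUpdate H s y) ≤ traceLogDet H + M - 1 - Real.log (1 - ν) -
      Real.log (‖g‖ ^ 2 / -inner ℝ g s) := by
  have hdet : IsUnit H.det := hH.det_pos.ne'.isUnit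
  set d := -inner ℝ g s with hd
  have hd0 : 0 < d := by rw [hd]; linarith
  have hν' : 0 < 1 - ν := by linarith
  have hsy0 : 0 < inner ℝ s y := lt_of_lt_of_le (by positivity) hsy
  have hg0 : 0 < ‖g‖ := norm_pos_iff.2 hg
  have hBs : H⁻¹ *ᵥ s.ofLp = -(c⁻¹ • g.ofLp) := by
    have h1 : s.ofLp = -(c⁻¹ • (H *ᵥ g.ofLp)) := by
      rw [hHg, smul_neg, smul_smul, inv_mul_cancel₀ hc.ne', one_smul, neg_neg]
    conv_lhs => rw [h1]
    rw [mulVec_neg, mulVec_smul, mulVec_mulVec, nonsing_inv_mul H hdet, one_mulVec]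
  have hsBs : s.ofLp ⬝ᵥ H⁻¹ *ᵥ s.ofLp = d / c := by
    rw [hBs, dotProduct_neg, dotProduct_smul, dotProduct_comm, ← inner_eq_dotProduct_ofLp, hd,
      smul_eq_mul]
    ring
  have hnorm : ∀ z : EuclideanSpace ℝ (Fin n), z.ofLp ⬝ᵥ z.ofLp = ‖z‖ ^ 2 := fun z => by
    rw [← inner_eq_dotProduct_ofLp, real_inner_self_eq_norm_sq]
  have htr : (bfgsUpdate H s y)⁻¹.trace =
      H⁻¹.trace - ‖g‖ ^ 2 / (c * d) + ‖y‖ ^ 2 / inner ℝ s y := by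
    rw [inv_bfgsUpdate hH hsy0, trace_add, trace_sub, trace_smul, trace_smul, trace_vecMulVec,
      trace_vecMulVec, hsBs, hBs, neg_dotProduct_neg, smul_dotProduct, dotProduct_smul, hnorm,
      hnorm]
    simp only [smul_eq_mul]
    field_simp
  have hlogdet : Real.log (bfgsUpdate H s y).det =
      Real.log H.det + (Real.log (d / inner ℝ s y) - Real.log c) := by
    rw [det_bfgsUpdate hH hsy0, hsBs, Real.log_mul hH.det_pos.ne' (by positivity),
      ← Real.log_div (by positivity) hc.ne']
    congr 2
    field_simp
  have h1 : Real.log (d / inner ℝ s y) ≤ -Real.log (1 - ν) := by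
    rw [← Real.log_inv]
    apply Real.log_le_log (by positivity)
    rw [div_le_iff₀ hsy0, inv_mul_eq_div, le_div_iff₀ hν']
    linarith
  have h2 : Real.log (‖g‖ ^ 2 / (c * d)) ≤ ‖g‖ ^ 2 / (c * d) - 1 :=
    Real.log_le_sub_one_of_pos (by positivity)
  have h3 : Real.log (‖g‖ ^ 2 / (c * d)) = Real.log (‖g‖ ^ 2 / d) - Real.log c := by
    rw [← Real.log_div (by positivity) hc.ne']
    congr 1
    field_simp
  have h4 : ‖y‖ ^ 2 / inner ℝ s y ≤ M := by rwa [div_le_iff₀ hsy0]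
  rw [traceLogDet, traceLogDet, htr, hlogdet]
  linarith

section Gradient

variable {E : Type*} [NormedAddCommGroup E] [InnerProductSpace ℝ E]

lemma ConvexOn.add_inner_gradient_le [CompleteSpace E] {U : Set E} {f : E → ℝ}
    (hf : ConvexOn ℝ U f) {a b : E} (ha : a ∈ U) (hb : b ∈ U) (hd : DifferentiableAt ℝ f a) :
    f a + inner ℝ (gradient f a) (b - a) ≤ f b := by
  have hconv := hf.comp_affineMap (AffineMap.lineMap a b : ℝ →ᵃ[ℝ] E)
  have hline : HasDerivAt (fun t : ℝ => AffineMap.lineMap a b t) (b - a) (0 : ℝ) :=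
    AffineMap.hasDerivAt_lineMap
  have hd' : HasFDerivAt f (fderiv ℝ f a) (AffineMap.lineMap a b (0 : ℝ)) := by
    simpa using hd.hasFDerivAt
  have hder := hd'.comp_hasDerivAt (0 : ℝ) hline
  have h := hconv.le_slope_of_hasDerivAt (x := 0) (y := 1) (by simpa using ha)
    (by simpa using hb) one_pos hder
  have hgrad : fderiv ℝ f a (b - a) = inner ℝ (gradient f a) (b - a) := by
    rw [← toDual_gradient, InnerProductSpace.toDual_apply_apply]
  rw [hgrad, slope_def_field] at h
  simp only [Function.comp_apply, AffineMap.lineMap_apply_one, AffineMap.lineMap_apply_zero,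
    sub_zero, div_one] at h
  linarith

lemma ConvexOn.inner_gradient_sub_nonneg [CompleteSpace E] {U : Set E} {f : E → ℝ}
    (hf : ConvexOn ℝ U f) {a b : E} (ha : a ∈ U) (hb : b ∈ U) (hda : DifferentiableAt ℝ f a)
    (hdb : DifferentiableAt ℝ f b) : 0 ≤ inner ℝ (b - a) (gradient f b - gradient f a) := by
  have h1 := hf.add_inner_gradient_le ha hb hda
  have h2 := hf.add_inner_gradient_le hb ha hdb
  rw [real_inner_comm, inner_sub_left]
  rw [← neg_sub b a, inner_neg_right] at h2
  linarith

lemma ContinuousLinearMap.exists_pos_mul_norm_sq_le_inner [FiniteDimensional ℝ E] (A : E →L[ℝ] E)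
    (hA : ∀ v, v ≠ 0 → 0 < inner ℝ v (A v)) : ∃ m > 0, ∀ v, m * ‖v‖ ^ 2 ≤ inner ℝ v (A v) := by
  rcases subsingleton_or_nontrivial E with hE | hE
  · exact ⟨1, one_pos, fun v => by simp [Subsingleton.elim v 0]⟩
  have hcomp : IsCompact (Metric.sphere (0 : E) 1) := isCompact_sphere 0 1
  have hne : (Metric.sphere (0 : E) 1).Nonempty := NormedSpace.sphere_nonempty.2 zero_le_one
  obtain ⟨u, hu, hmin⟩ := hcomp.exists_isMinOn hne
    (f := fun v => inner ℝ v (A v)) (by fun_prop)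
  have hu1 : ‖u‖ = 1 := by simpa using hu
  refine ⟨inner ℝ u (A u), hA u (by rintro rfl; simp at hu1), fun v => ?_⟩
  rcases eq_or_ne v 0 with rfl | hv
  · simp
  have hv0 : 0 < ‖v‖ := norm_pos_iff.2 hv
  have hmem : ‖v‖⁻¹ • v ∈ Metric.sphere (0 : E) 1 := by
    simp [norm_smul, hv0.ne']
  have h := hmin hmem
  simp only [Set.mem_ofPred_eq, map_smul, inner_smul_left, inner_smul_right, conj_trivial] at h
  calc inner ℝ u (A u) * ‖v‖ ^ 2 ≤ (‖v‖⁻¹ * (‖v‖⁻¹ * inner ℝ v (A v))) * ‖v‖ ^ 2 := by gcongr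
    _ = inner ℝ v (A v) := by field_simp

/-- A map with a positive definite strict derivative is locally strongly monotone and
Lipschitz. -/
lemma eventually_strongly_monotone_of_hasStrictFDerivAt [FiniteDimensional ℝ E] {G : E → E}
    {A : E →L[ℝ] E} {a : E} (hG : HasStrictFDerivAt G A a)
    (hA : ∀ v, v ≠ 0 → 0 < inner ℝ v (A v)) :
    ∃ m > 0, ∃ C ≥ 0, ∀ᶠ p in 𝓝 (a, a),
      m * ‖p.1 - p.2‖ ^ 2 ≤ inner ℝ (p.1 - p.2) (G p.1 - G p.2) ∧
      ‖G p.1 - G p.2‖ ≤ C * ‖p.1 - p.2‖ := by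
  obtain ⟨m, hm, hmA⟩ := A.exists_pos_mul_norm_sq_le_inner hA
  refine ⟨m / 2, by positivity, ‖A‖ + m / 2, by positivity, ?_⟩
  filter_upwards [hG.isLittleO.def (half_pos hm)] with p hp
  have hsplit : G p.1 - G p.2 = A (p.1 - p.2) + (G p.1 - G p.2 - A (p.1 - p.2)) := by abel
  constructor
  · have h1 := (abs_le.1 (abs_real_inner_le_norm (p.1 - p.2)
      (G p.1 - G p.2 - A (p.1 - p.2)))).1
    have h2 := mul_le_mul_of_nonneg_left hp (norm_nonneg (p.1 - p.2))
    have h3 := hmA (p.1 - p.2)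
    rw [hsplit, inner_add_right]
    nlinarith
  · rw [hsplit]
    calc _ ≤ ‖A (p.1 - p.2)‖ + ‖G p.1 - G p.2 - A (p.1 - p.2)‖ := norm_add_le _ _
      _ ≤ ‖A‖ * ‖p.1 - p.2‖ + m / 2 * ‖p.1 - p.2‖ := add_le_add (A.le_opNorm _) hp
      _ = _ := by ring

end Gradient

section Smooth

variable {n : ℕ} {f : EuclideanSpace ℝ (Fin n) → ℝ} {U V : Set (EuclideanSpace ℝ (Fin n))}

lemma HasContinuousPosDefHessianOn.hasStrictFDerivAt (h : HasContinuousPosDefHessianOn f V)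
    (hV : IsOpen V) {a : EuclideanSpace ℝ (Fin n)} (ha : a ∈ V) :
    HasStrictFDerivAt (gradient f) (hessian f a) a := by
  refine hasStrictFDerivAt_of_hasFDerivAt_of_continuousAt (𝕜 := ℝ) ?_
    (h.2.1.continuousAt (hV.mem_nhds ha))
  filter_upwards [hV.mem_nhds ha] with z hz using (h.1 z hz).2.hasFDerivAt

/-- The gradient of a convex function is strictly monotone where the Hessian is positive
definite, even if the segment between the two points leaves that region. -/
lemma HasContinuousPosDefHessianOn.inner_gradient_sub_pos (h : HasContinuousPosDefHessianOn f V)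
    (hV : IsOpen V) (hVU : V ⊆ U) (hf : ConvexOn ℝ U f) {a b : EuclideanSpace ℝ (Fin n)}
    (ha : a ∈ V) (hb : b ∈ V) (hab : a ≠ b) :
    0 < inner ℝ (b - a) (gradient f b - gradient f a) := by
  obtain ⟨m, hm, C, -, hev⟩ := eventually_strongly_monotone_of_hasStrictFDerivAt
    (h.hasStrictFDerivAt hV ha) (h.2.2 a ha)
  have hcont : Tendsto (fun t : ℝ => a + t • (b - a)) (𝓝[>] 0) (𝓝 a) := by
    have : ContinuousAt (fun t : ℝ => a + t • (b - a)) 0 := by fun_prop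
    simpa using this.tendsto.mono_left nhdsWithin_le_nhds
  have hlt : ∀ᶠ t : ℝ in 𝓝[>] 0, t < 1 := nhdsWithin_le_nhds (gt_mem_nhds one_pos)
  obtain ⟨t, ⟨⟨⟨hmono, -⟩, hpV⟩, ht1⟩, ht0⟩ :=
    ((((hcont.prodMk_nhds tendsto_const_nhds).eventually hev).and
      (hcont.eventually (hV.mem_nhds ha))).and hlt).and self_mem_nhdsWithin |>.exists
  have ht0 : 0 < t := ht0
  set p := a + t • (b - a) with hp
  have hpa : p - a = t • (b - a) := by rw [hp]; abel
  have hbp : b - p = (1 - t) • (b - a) := by rw [hp, sub_smul, one_smul]; abel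
  have hba : 0 < ‖b - a‖ := norm_pos_iff.2 (sub_ne_zero.2 hab.symm)
  have h1 : 0 < inner ℝ (b - a) (gradient f p - gradient f a) := by
    have h0 : 0 < m * ‖p - a‖ ^ 2 := by
      rw [hpa, norm_smul, Real.norm_of_nonneg ht0.le]; positivity
    have := h0.trans_le hmono
    simp only [hpa, inner_smul_left, conj_trivial] at this
    exact pos_of_mul_pos_right this ht0.le
  have h2 : 0 ≤ inner ℝ (b - a) (gradient f b - gradient f p) := by
    have := hf.inner_gradient_sub_nonneg (hVU hpV) (hVU hb) (h.1 p hpV).1 (h.1 b hb).1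
    simp only [hbp, inner_smul_left, conj_trivial] at this
    exact nonneg_of_mul_nonneg_right this (by linarith)
  have h3 : gradient f b - gradient f a =
      (gradient f b - gradient f p) + (gradient f p - gradient f a) := by abel
  rw [h3, inner_add_right]
  linarith

lemma HasContinuousPosDefHessianOn.exists_norm_gradient_sub_sq_le
    (h : HasContinuousPosDefHessianOn f V) (hV : IsOpen V) (hVU : V ⊆ U) (hf : ConvexOn ℝ U f)
    {K : Set (EuclideanSpace ℝ (Fin n))} (hK : IsCompact K) (hKV : K ⊆ V) :
    ∃ M : ℝ, ∀ a ∈ K, ∀ b ∈ K, ‖gradient f b - gradient f a‖ ^ 2 ≤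
      M * inner ℝ (b - a) (gradient f b - gradient f a) := by
  have hnn : ∀ p ∈ K ×ˢ K, 0 ≤ inner ℝ (p.1 - p.2) (gradient f p.1 - gradient f p.2) :=
    fun p hp => hf.inner_gradient_sub_nonneg (hVU (hKV hp.2)) (hVU (hKV hp.1))
      (h.1 _ (hKV hp.2)).1 (h.1 _ (hKV hp.1)).1
  suffices ∃ M : ℝ, 0 ≤ M ∧ ∀ p ∈ K ×ˢ K, p ∈ K ×ˢ K →
      ‖gradient f p.1 - gradient f p.2‖ ^ 2 ≤
      M * inner ℝ (p.1 - p.2) (gradient f p.1 - gradient f p.2) by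
    obtain ⟨M, -, hM⟩ := this
    exact ⟨M, fun a ha b hb => hM (b, a) ⟨hb, ha⟩ ⟨hb, ha⟩⟩
  refine (hK.prod hK).induction_on (p := fun S => ∃ M : ℝ, 0 ≤ M ∧ ∀ p ∈ S, p ∈ K ×ˢ K →
      ‖gradient f p.1 - gradient f p.2‖ ^ 2 ≤
      M * inner ℝ (p.1 - p.2) (gradient f p.1 - gradient f p.2)) ⟨0, le_rfl, by simp⟩ ?_ ?_ ?_
  · rintro S T hST ⟨M, hM0, hM⟩
    exact ⟨M, hM0, fun p hp => hM p (hST hp)⟩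
  · rintro S T ⟨M, hM0, hM⟩ ⟨N, hN0, hN⟩
    refine ⟨M + N, by positivity, fun p hp hpK => ?_⟩
    have hp0 := hnn p hpK
    rcases hp with hp | hp
    · have := hM p hp hpK; nlinarith
    · have := hN p hp hpK; nlinarith
  · rintro ⟨a, b⟩ ⟨ha, hb⟩
    suffices ∃ M : ℝ, 0 ≤ M ∧ ∀ᶠ p in 𝓝 (a, b), ‖gradient f p.1 - gradient f p.2‖ ^ 2 ≤
        M * inner ℝ (p.1 - p.2) (gradient f p.1 - gradient f p.2) by
      obtain ⟨M, hM0, hM⟩ := this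
      exact ⟨_, nhdsWithin_le_nhds hM, M, hM0, fun p hp _ => hp⟩
    rcases eq_or_ne a b with rfl | hab
    · obtain ⟨m, hm, C, hC, hev⟩ :=
        eventually_strongly_monotone_of_hasStrictFDerivAt
          (h.hasStrictFDerivAt hV (hKV ha)) (h.2.2 a (hKV ha))
      refine ⟨C ^ 2 / m, by positivity, ?_⟩
      filter_upwards [hev] with p hp
      calc ‖gradient f p.1 - gradient f p.2‖ ^ 2 ≤ (C * ‖p.1 - p.2‖) ^ 2 := by
            gcongr; exact hp.2
        _ = C ^ 2 / m * (m * ‖p.1 - p.2‖ ^ 2) := by field_simp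
        _ ≤ _ := by gcongr; exact hp.1
    · have hpos := h.inner_gradient_sub_pos hV hVU hf (hKV hb) (hKV ha) hab.symm
      have hca : ContinuousAt (gradient f) a := (h.1 a (hKV ha)).2.continuousAt
      have hcb : ContinuousAt (gradient f) b := (h.1 b (hKV hb)).2.continuousAt
      have hc1 : ContinuousAt (fun p : _ × _ => gradient f p.1) (a, b) :=
        ContinuousAt.comp' (f := Prod.fst) hca continuousAt_fst
      have hc2 : ContinuousAt (fun p : _ × _ => gradient f p.2) (a, b) :=
        ContinuousAt.comp' (f := Prod.snd) hcb continuousAt_snd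
      set q := inner ℝ (a - b) (gradient f a - gradient f b) with hq
      set r := ‖gradient f a - gradient f b‖ ^ 2 with hr
      have hM : r < (r + 1) / q * q := by
        rw [div_mul_cancel₀ _ hpos.ne']; linarith
      refine ⟨(r + 1) / q, by positivity, ?_⟩
      refine (ContinuousAt.eventually_lt (x₀ := (a, b))
        (f := fun p : _ × _ => ‖gradient f p.1 - gradient f p.2‖ ^ 2)
        (g := fun p : _ × _ => (r + 1) / q *
          inner ℝ (p.1 - p.2) (gradient f p.1 - gradient f p.2))
        (by fun_prop) (continuousAt_const.mul ((continuousAt_fst.sub continuousAt_snd).inner (𝕜 := ℝ)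
          (hc1.sub hc2))) hM).mono fun p hp => hp.le

end Smooth

/-- Under the Wolfe conditions, a positive definite matrix `H` with `H g ∈ -ℝ₊ s` makes `s` a
descent direction along which the curvature condition holds. -/
lemma descent_of_mulVec_eq {n : ℕ} {H : Matrix (Fin n) (Fin n) ℝ} (hH : H.PosDef)
    {s g g' : EuclideanSpace ℝ (Fin n)} {c ν : ℝ} (hg : g ≠ 0) (hc : 0 ≤ c)
    (hHg : H.mulVec g.ofLp = -(c • s.ofLp)) (hν : ν * inner ℝ g s ≤ inner ℝ g' s) :
    0 < c ∧ inner ℝ g s < 0 ∧ (1 - ν) * -inner ℝ g s ≤ inner ℝ s (g' - g) := by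
  have hg' : g.ofLp ≠ 0 := fun h => hg (by ext i; simp [h])
  have hpos : 0 < g.ofLp ⬝ᵥ H.mulVec g.ofLp := by simpa using hH.dotProduct_mulVec_pos hg'
  rw [hHg, dotProduct_neg, dotProduct_smul, ← inner_eq_dotProduct_ofLp, smul_eq_mul] at hpos
  have hc0 : 0 < c := hc.lt_of_ne (by rintro rfl; simp at hpos)
  refine ⟨hc0, by nlinarith, ?_⟩
  rw [inner_sub_right, real_inner_comm g' s, real_inner_comm g s]
  linarith

theorem mainTheorem5 {n : ℕ} (U : Set (EuclideanSpace ℝ (Fin n)))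
    (hUopen : IsOpen U) (hUconv : Convex ℝ U)
    (f : EuclideanSpace ℝ (Fin n) → ℝ) (hf : ConvexOn ℝ U f)
    (x : ℕ → EuclideanSpace ℝ (Fin n)) (hxU : ∀ k, x k ∈ U)
    (hx : IsBFGSSequence f x)
    (hlevel : IsCompact {z ∈ U | f z ≤ f (x 0)})
    (hsmooth : HasContinuousPosDefHessianOn f {z ∈ U | sInf (f '' U) < f z}) :
    IsLeast (f '' U) (sInf (f '' U)) ∧
      Tendsto (fun k => f (x k)) atTop (𝓝 (sInf (f '' U))) := by
  have hcont : ContinuousOn f U := hf.continuousOn hUopen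
  obtain ⟨z, ⟨hzU, hz0⟩, hzmin⟩ := hlevel.exists_isMinOn ⟨x 0, hxU 0, le_rfl⟩
    (hcont.mono fun w hw => hw.1)
  have hzU_min : ∀ w ∈ U, f z ≤ f w := fun w hw => by
    rcases le_total (f w) (f (x 0)) with h | h
    · exact hzmin (show w ∈ {z ∈ U | f z ≤ f (x 0)} from ⟨hw, h⟩)
    · exact hz0.trans h
  have hleast : IsLeast (f '' U) (f z) :=
    ⟨⟨z, hzU, rfl⟩, by rintro _ ⟨w, hw, rfl⟩; exact hzU_min w hw⟩
  rw [hleast.csInf_eq] at hsmooth ⊢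
  refine ⟨hleast, ?_⟩
  obtain ⟨hdiff, μ, ν, H₀, hμ, hμν, hν1, hH₀, hstep⟩ := hx
  set g := fun k => gradient f (x k) with hgdef
  set s := fun k => x (k + 1) - x k with hsdef
  set H := bfgsMatrix f x H₀ with hHdef
  have hHpos : ∀ k, (H k).PosDef := by
    intro k
    induction k with
    | zero => exact hH₀
    | succ k ih =>
      obtain ⟨⟨c, hc, hHg⟩, -, hwolfe⟩ := hstep k
      obtain ⟨-, hgs, hsy⟩ := descent_of_mulVec_eq ih (hdiff k).2 hc hHg hwolfe
      exact bfgsUpdate_posDef ih (lt_of_lt_of_le (by nlinarith) hsy)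
  have hdesc : ∀ k, inner ℝ (g k) (s k) < 0 := fun k => by
    obtain ⟨⟨c, hc, hHg⟩, -, hwolfe⟩ := hstep k
    exact (descent_of_mulVec_eq (hHpos k) (hdiff k).2 hc hHg hwolfe).2.1
  have harmijo : ∀ k, f (x (k + 1)) ≤ f (x k) + μ * inner ℝ (g k) (s k) := fun k => (hstep k).2.1
  have hanti : Antitone fun k => f (x k) := antitone_nat_of_succ_le fun k => by
    have := harmijo k
    have := mul_neg_of_pos_of_neg hμ (hdesc k)
    linarith
  have hbdd : BddBelow (Set.range fun k => f (x k)) :=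
    ⟨f z, by rintro _ ⟨k, rfl⟩; exact hzU_min _ (hxU k)⟩
  have hlim := tendsto_atTop_ciInf hanti hbdd
  set c := ⨅ k, f (x k) with hc
  have hcle : ∀ k, c ≤ f (x k) := fun k => ciInf_le hbdd k
  have hzc : f z ≤ c := le_ciInf fun k => hzU_min _ (hxU k)
  rcases hzc.eq_or_lt with heq | hlt
  · rwa [heq]
  exfalso
  have hdlim : Tendsto (fun k => -inner ℝ (g k) (s k)) atTop (𝓝 0) := by
    have h0 : Tendsto (fun k => μ⁻¹ * (f (x k) - f (x (k + 1)))) atTop (𝓝 0) := by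
      simpa using (hlim.sub (hlim.comp (tendsto_add_atTop_nat 1))).const_mul μ⁻¹
    refine squeeze_zero (fun k => by linarith [hdesc k]) (fun k => ?_) h0
    rw [inv_mul_eq_div, le_div_iff₀ hμ]
    linarith [harmijo k]
  have hVopen : IsOpen {w ∈ U | f z < f w} := hcont.isOpen_inter_preimage hUopen isOpen_Ioi
  have hKcomp : IsCompact {w ∈ {w ∈ U | f w ≤ f (x 0)} | c ≤ f w} :=
    hlevel.of_isClosed_subset ((hcont.mono fun w hw => hw.1).preimage_isClosed_of_isClosed
      hlevel.isClosed isClosed_Ici) (fun w hw => hw.1)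
  obtain ⟨M, hM⟩ := hsmooth.exists_norm_gradient_sub_sq_le hVopen (fun w hw => hw.1) hf hKcomp
    (fun w hw => ⟨hw.1.1, hlt.trans_le hw.2⟩)
  have hxL : ∀ k, x k ∈ {w ∈ U | f w ≤ f (x 0)} := fun k => ⟨hxU k, hanti (Nat.zero_le k)⟩
  obtain ⟨R, hR⟩ := hlevel.isBounded.exists_norm_le
  have hgnorm : ∃ ε > 0, ∀ k, ε ≤ ‖g k‖ := by
    have hR0 : 0 ≤ R := (norm_nonneg _).trans (hR _ (hxL 0))
    refine ⟨(c - f z) / (2 * R + 1), div_pos (by linarith) (by linarith), fun k => ?_⟩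
    rw [div_le_iff₀ (by linarith)]
    have h1 := hf.add_inner_gradient_le (hxU k) hzU (hdiff k).1
    have h2 := (abs_le.1 (abs_real_inner_le_norm (g k) (z - x k))).1
    have h3 : ‖z - x k‖ ≤ 2 * R + 1 := by
      linarith [norm_sub_le z (x k), hR _ ⟨hzU, hz0⟩, hR _ (hxL k)]
    have h4 := mul_le_mul_of_nonneg_left h3 (norm_nonneg (g k))
    have h5 := hcle k
    simp only [hgdef] at *
    linarith
  obtain ⟨ε, hε, hεg⟩ := hgnorm
  have hdecr : ∀ k, traceLogDet (H (k + 1)) ≤ traceLogDet (H k) + M - 1 - Real.log (1 - ν) -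
      Real.log (‖g k‖ ^ 2 / -inner ℝ (g k) (s k)) := fun k => by
    obtain ⟨⟨c, hc, hHg⟩, -, hwolfe⟩ := hstep k
    obtain ⟨hc0, hgs, hsy⟩ := descent_of_mulVec_eq (hHpos k) (hdiff k).2 hc hHg hwolfe
    exact traceLogDet_bfgsUpdate_le (hHpos k) hc0 (hdiff k).2 hHg hν1 hgs hsy
      (hM _ ⟨hxL k, hcle k⟩ _ ⟨hxL (k + 1), hcle (k + 1)⟩)
  have hlarge : ∀ᶠ k in atTop, M - Real.log (1 - ν) ≤
      Real.log (‖g k‖ ^ 2 / -inner ℝ (g k) (s k)) := by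
    set T := Real.exp (M - Real.log (1 - ν)) with hT
    have hT0 : 0 < T := Real.exp_pos _
    filter_upwards [hdlim.eventually (gt_mem_nhds (show 0 < ε ^ 2 / T by positivity))] with k hk
    have hd0 : 0 < -inner ℝ (g k) (s k) := by linarith [hdesc k]
    have hg0 : 0 < ‖g k‖ := hε.trans_le (hεg k)
    rw [Real.le_log_iff_exp_le (by positivity), le_div_iff₀ hd0]
    rw [lt_div_iff₀ hT0] at hk
    have : ε ^ 2 ≤ ‖g k‖ ^ 2 := by gcongr; exact hεg k
    linarith
  obtain ⟨N, hN⟩ := eventually_atTop.1 hlarge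
  have hbound : ∀ j : ℕ, traceLogDet (H (N + j)) ≤ traceLogDet (H N) - j := by
    intro j
    induction j with
    | zero => simp
    | succ j ih =>
      have h1 := hdecr (N + j)
      have h2 := hN (N + j) (Nat.le_add_right N j)
      rw [← add_assoc]
      push_cast
      linarith
  obtain ⟨j, hj⟩ := exists_nat_gt (traceLogDet (H N))
  linarith [hbound j, traceLogDet_nonneg (hHpos (N + j))]
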